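/- Let $K$ be a field of characteristic $0$, let $S=K[x_1,\dots,x_l]$ with the standard grading, and let $I$ be a homogeneous ideal of $S$. A graded $K$-algebra $R=\bigoplus_{i\ge 0}R_i$ with finite-dimensional components has the weak Lefschetz property (WLP) if there is $\ell\in R_1$ such that the multiplication map $\times\ell\colon R_i\to R_{i+1}$ has full rank (that is, is injective or surjective) for every $i\ge 0$. Let $\beta_{i,j}(I)$ be the graded Betti numbers of $I$, that is, the number of summands $S(-j)$ in homological degree $i$ of a minimal graded free resolution of $I$, and let $$\operatorname{reg}(I)=\max\{\,j-i \mid \beta_{i,j}(I)\neq 0\,\}$$ be the Castelnuovo--Mumford regularity of $I$ (for $I=0$ put $\operatorname{reg}(I)=0$). For $I\neq 0$ this maximum exists, so that only finitely many $i\geq 0$ satisfy $i\le\operatorname{reg}(I)-1$, and the following are equivalent for every homogeneous ideal $I$: 1. the graded ring $S/I$ has the WLP; 2. there exists $\ell\in(S/I)_1$ such that the multiplication map $\times\ell\colon(S/I)_i\to(S/I)_{i+1}$ has full rank for every $0\le i\le\operatorname{reg}(I)-1$. -/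

import Mathlib

attribute [local instance] MvPolynomial.gradedAlgebra

namespace Lefschetz

section GradedRing

variable {K R : Type*} [Field K] [CommRing R] [Algebra K R]

/-- Multiplication by a degree-one element `ℓ`, as a `K`-linear map `R_i → R_{i+1}`. -/
def mulMap (𝒜 : ℕ → Submodule K R) [SetLike.GradedMonoid 𝒜] (ℓ : 𝒜 1) (i : ℕ) :
    𝒜 i →ₗ[K] 𝒜 (i + 1) :=
  (LinearMap.mulLeft K (ℓ : R)).restrict fun x hx => by
    have h := SetLike.mul_mem_graded (A := 𝒜) ℓ.2 hx
    rwa [add_comm] at h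

/-- A linear map has full rank if it is injective or surjective. Between finite-dimensional
spaces this says that its rank is the smaller one of the two dimensions. -/
def FullRank {V W : Type*} [AddCommGroup V] [Module K V] [AddCommGroup W] [Module K W]
    (f : V →ₗ[K] W) : Prop :=
  Function.Injective f ∨ Function.Surjective f

/-- The weak Lefschetz property of a graded ring `R = ⨁ 𝒜 i` over `K`. -/
def HasWLP (𝒜 : ℕ → Submodule K R) [SetLike.GradedMonoid 𝒜] : Prop :=
  ∃ ℓ : 𝒜 1, ∀ i : ℕ, FullRank (mulMap 𝒜 ℓ i)

end GradedRing

section Polynomial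

variable {K : Type*} [Field K] {l : ℕ}

/-- The homogeneous component `(S/I)_i` of `S/I`, where `S = K[x_1, …, x_l]`: the image of the
space of forms of degree `i`. -/
noncomputable def quotientGrading (I : Ideal (MvPolynomial (Fin l) K)) (i : ℕ) :
    Submodule K (MvPolynomial (Fin l) K ⧸ I) :=
  (MvPolynomial.homogeneousSubmodule (Fin l) K i).map (Ideal.Quotient.mkₐ K I).toLinearMap

instance quotientGrading.gradedMonoid (I : Ideal (MvPolynomial (Fin l) K)) :
    SetLike.GradedMonoid (quotientGrading I) where
  one_mem := ⟨1, MvPolynomial.isHomogeneous_one _ _, map_one (Ideal.Quotient.mkₐ K I)⟩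
  mul_mem := by
    rintro i j _ _ ⟨f, hf, rfl⟩ ⟨g, hg, rfl⟩
    exact ⟨f * g, MvPolynomial.IsHomogeneous.mul hf hg, map_mul (Ideal.Quotient.mkₐ K I) f g⟩

/-- A minimal graded free resolution `⋯ → F_2 → F_1 → F_0 → I → 0` of an ideal `I` of
`S = K[x_1, …, x_l]`, in coordinates: `F_i = ⨁_k S(-deg i k)`, with `k < rank i`. The map
`F_{i+1} → F_i` is given by the matrix `d i`, and `F_0 → I` sends the `k`-th basis vector to
`gen k`. -/
structure MinimalGradedFreeResolution (I : Ideal (MvPolynomial (Fin l) K)) where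
  rank : ℕ → ℕ
  deg : (i : ℕ) → Fin (rank i) → ℕ
  gen : Fin (rank 0) → MvPolynomial (Fin l) K
  d : (i : ℕ) → Matrix (Fin (rank i)) (Fin (rank (i + 1))) (MvPolynomial (Fin l) K)
  /-- The augmentation `F_0 → I` is homogeneous of degree `0`. -/
  gen_homogeneous : ∀ k, (gen k).IsHomogeneous (deg 0 k)
  /-- The maps `F_{i+1} → F_i` are homogeneous of degree `0`. -/
  d_homogeneous : ∀ i r c, d i r c = 0 ∨
    ∃ n, deg i r + n = deg (i + 1) c ∧ (d i r c).IsHomogeneous n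
  /-- Exactness at `I`. -/
  span_gen : Ideal.span (Set.range gen) = I
  /-- Exactness at `F_0`. -/
  exact_zero : Function.Exact (d 0).mulVecLin
    (Fintype.linearCombination (MvPolynomial (Fin l) K) gen)
  /-- Exactness at `F_{i+1}`. -/
  exact_succ : ∀ i, Function.Exact (d (i + 1)).mulVecLin (d i).mulVecLin
  /-- Minimality: the entries of the matrices lie in the ideal `(x_1, …, x_l)`. -/
  minimal : ∀ i r c, MvPolynomial.constantCoeff (d i r c) = 0

open Classical in
/-- The graded Betti number `β_{i,j}(I)`: the number of summands `S(-j)` of `F_i` in a minimal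
graded free resolution of `I`. Every homogeneous ideal has such a resolution, and any two of them
are isomorphic. -/
noncomputable def gradedBetti (I : Ideal (MvPolynomial (Fin l) K)) (i j : ℕ) : ℕ :=
  if h : Nonempty (MinimalGradedFreeResolution I) then
    (Finset.univ.filter fun k : Fin (h.some.rank i) => h.some.deg i k = j).card
  else 0

/-- The numbers `j - i` with `β_{i,j}(I) ≠ 0`. -/
def regularitySet (I : Ideal (MvPolynomial (Fin l) K)) : Set ℤ :=
  {r | ∃ i j : ℕ, gradedBetti I i j ≠ 0 ∧ r = (j : ℤ) - (i : ℤ)}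

/-- The Castelnuovo–Mumford regularity of `I`, the largest `j - i` with `β_{i,j}(I) ≠ 0`. For
`I = 0` there are no such numbers, and the value is `0`. -/
noncomputable def regularity (I : Ideal (MvPolynomial (Fin l) K)) : ℤ :=
  sSup (regularitySet I)

end Polynomial

end Lefschetz

namespace Lefschetz

open MvPolynomial

section GradedVectors

variable {K : Type*} [Field K] {l : ℕ}

theorem coe_decompose_eq_homogeneousComponent (f : MvPolynomial (Fin l) K) (n : ℕ) :
    (DirectSum.decompose (homogeneousSubmodule (Fin l) K) f n : MvPolynomial (Fin l) K) =
      homogeneousComponent n f :=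
  decomposition.decompose'_apply f n

theorem homogeneousComponent_mul_of_isHomogeneous {f : MvPolynomial (Fin l) K} {n : ℕ}
    (hf : f.IsHomogeneous n) (g : MvPolynomial (Fin l) K) (m : ℕ) :
    homogeneousComponent (m + n) (f * g) = f * homogeneousComponent m g := by
  have h := DirectSum.coe_decompose_mul_of_left_mem_of_le
    (homogeneousSubmodule (Fin l) K) (a := f) (b := g) (i := n) (n := m + n) hf (by omega)
  rwa [Nat.add_sub_cancel, coe_decompose_eq_homogeneousComponent,
    coe_decompose_eq_homogeneousComponent] at h

theorem homogeneousComponent_mul_eq_zero_of_isHomogeneous {f : MvPolynomial (Fin l) K} {n : ℕ}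
    (hf : f.IsHomogeneous n) (g : MvPolynomial (Fin l) K) {m : ℕ} (hm : m < n) :
    homogeneousComponent m (f * g) = 0 := by
  rw [← coe_decompose_eq_homogeneousComponent]
  exact DirectSum.coe_decompose_mul_of_left_mem_of_not_le
    (homogeneousSubmodule (Fin l) K) (a := f) (b := g) (i := n) (n := m) hf (by omega)

/-- The component of degree `j` of a vector in the graded free module `⨁_k S(-a k)`. -/
noncomputable def gradedPart {n : ℕ} (a : Fin n → ℕ) (j : ℕ) (v : Fin n → MvPolynomial (Fin l) K) :
    Fin n → MvPolynomial (Fin l) K :=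
  fun k => if a k ≤ j then homogeneousComponent (j - a k) (v k) else 0

/-- A vector in the graded free module `⨁_k S(-a k)` that is homogeneous of degree `j`. -/
def IsGradedVector {n : ℕ} (a : Fin n → ℕ) (j : ℕ) (v : Fin n → MvPolynomial (Fin l) K) : Prop :=
  ∀ k, v k = 0 ∨ ∃ m, a k + m = j ∧ (v k).IsHomogeneous m

/-- A matrix that defines a map `⨁_c S(-b c) → ⨁_r S(-a r)` homogeneous of degree `0`. -/
def IsGradedMatrix {m n : ℕ} (a : Fin m → ℕ) (b : Fin n → ℕ)
    (d : Matrix (Fin m) (Fin n) (MvPolynomial (Fin l) K)) : Prop :=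
  ∀ r c, d r c = 0 ∨ ∃ n, a r + n = b c ∧ (d r c).IsHomogeneous n

theorem isGradedVector_gradedPart {n : ℕ} (a : Fin n → ℕ) (j : ℕ)
    (v : Fin n → MvPolynomial (Fin l) K) : IsGradedVector a j (gradedPart a j v) := by
  intro k
  unfold gradedPart
  split_ifs with h
  · exact Or.inr ⟨j - a k, by omega, homogeneousComponent_isHomogeneous _ _⟩
  · exact Or.inl rfl

theorem IsGradedVector.gradedPart_eq {n : ℕ} {a : Fin n → ℕ} {j : ℕ}
    {v : Fin n → MvPolynomial (Fin l) K} (h : IsGradedVector a j v) : gradedPart a j v = v := by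
  funext k
  unfold gradedPart
  rcases h k with h | ⟨m, hm, h⟩
  · simp [h]
  · rw [if_pos (by omega), show j - a k = m by omega]
    exact homogeneousComponent_eq_self h

theorem gradedPart_zero {n : ℕ} (a : Fin n → ℕ) (j : ℕ) :
    gradedPart a j (0 : Fin n → MvPolynomial (Fin l) K) = 0 := by
  funext k
  simp [gradedPart]

theorem IsGradedMatrix.mulVec_gradedPart {m n : ℕ} {a : Fin m → ℕ} {b : Fin n → ℕ}
    {d : Matrix (Fin m) (Fin n) (MvPolynomial (Fin l) K)} (hd : IsGradedMatrix a b d) (j : ℕ)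
    (v : Fin n → MvPolynomial (Fin l) K) :
    d.mulVec (gradedPart b j v) = gradedPart a j (d.mulVec v) := by
  funext r
  have key : ∀ c, d r c * gradedPart b j v c =
      if a r ≤ j then homogeneousComponent (j - a r) (d r c * v c) else 0 := by
    intro c
    unfold gradedPart
    rcases hd r c with h | ⟨p, hp, h⟩
    · simp [h]
    · by_cases hb : b c ≤ j
      · rw [if_pos hb, if_pos (by omega), show j - a r = (j - b c) + p by omega,
          homogeneousComponent_mul_of_isHomogeneous h]
      · rw [if_neg hb, mul_zero]
        split_ifs with ha
        · rw [homogeneousComponent_mul_eq_zero_of_isHomogeneous h _ (by omega)]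
        · rfl
  simp only [Matrix.mulVec, dotProduct, key]
  simp only [gradedPart]
  split_ifs with ha
  · exact (map_sum _ _ _).symm
  · simp

theorem exists_sum_gradedPart {n : ℕ} (a : Fin n → ℕ) (v : Fin n → MvPolynomial (Fin l) K) :
    ∃ N : ℕ, ∑ j ∈ Finset.range N, gradedPart a j v = v := by
  refine ⟨(Finset.univ.sup fun k => a k + (v k).totalDegree) + 1, ?_⟩
  set N := (Finset.univ.sup fun k => a k + (v k).totalDegree) + 1 with hN
  funext k
  have hk : a k + (v k).totalDegree + 1 ≤ N := by
    have := Finset.le_sup (f := fun k => a k + (v k).totalDegree) (Finset.mem_univ k)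
    omega
  rw [Finset.sum_apply]
  obtain ⟨q, hq⟩ : ∃ q, N = a k + ((v k).totalDegree + 1 + q) := 
    ⟨N - (a k + (v k).totalDegree + 1), by omega⟩
  rw [hq, Finset.sum_range_add, Finset.sum_eq_zero, zero_add, Finset.sum_range_add,
    Finset.sum_eq_zero (s := Finset.range q), add_zero]
  · conv_rhs => rw [← sum_homogeneousComponent (v k)]
    refine Finset.sum_congr rfl fun i _ => ?_
    simp [gradedPart]
  · intro i _
    simp only [gradedPart]
    rw [if_pos (by omega), homogeneousComponent_eq_zero]
    omega
  · intro i hi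
    rw [Finset.mem_range] at hi
    simp only [gradedPart]
    rw [if_neg (by omega)]

/-- Graded submodules of `⨁_k S(-a k)`. -/
def IsGradedSubmodule {n : ℕ} (a : Fin n → ℕ)
    (N : Submodule (MvPolynomial (Fin l) K) (Fin n → MvPolynomial (Fin l) K)) : Prop :=
  ∀ j, ∀ v ∈ N, gradedPart a j v ∈ N

theorem IsGradedMatrix.isGradedSubmodule_ker {m n : ℕ} {a : Fin m → ℕ} {b : Fin n → ℕ}
    {d : Matrix (Fin m) (Fin n) (MvPolynomial (Fin l) K)} (hd : IsGradedMatrix a b d) :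
    IsGradedSubmodule b (LinearMap.ker d.mulVecLin) := by
  intro j v hv
  rw [LinearMap.mem_ker, Matrix.mulVecLin_apply] at hv ⊢
  rw [hd.mulVec_gradedPart, hv, gradedPart_zero]

theorem IsGradedSubmodule.exists_homogeneous_generators {n : ℕ} {a : Fin n → ℕ}
    {N : Submodule (MvPolynomial (Fin l) K) (Fin n → MvPolynomial (Fin l) K)}
    (hN : IsGradedSubmodule a N) :
    ∃ (m : ℕ) (b : Fin m → ℕ) (d : Matrix (Fin n) (Fin m) (MvPolynomial (Fin l) K)),
      IsGradedMatrix a b d ∧ LinearMap.range d.mulVecLin = N := by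
  obtain ⟨T, hT⟩ := IsNoetherian.noetherian N
  choose B hB using fun v : Fin n → MvPolynomial (Fin l) K => exists_sum_gradedPart a v
  let ι := Σ t : T, Fin (B t)
  let e := Fintype.equivFin ι
  refine ⟨Fintype.card ι, fun c => (e.symm c).2,
    Matrix.of fun r c => gradedPart a (e.symm c).2 (e.symm c).1 r, ?_, ?_⟩
  · intro r c
    exact isGradedVector_gradedPart a _ _ r
  · rw [Matrix.range_mulVecLin]
    apply le_antisymm
    · rw [Submodule.span_le]
      rintro _ ⟨c, rfl⟩
      refine hN _ _ ?_
      rw [← hT]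
      exact Submodule.subset_span (e.symm c).1.2
    · rw [← hT, Submodule.span_le]
      intro t ht
      rw [SetLike.mem_coe, ← hB t]
      refine Submodule.sum_mem _ fun j hj => ?_
      rw [Finset.mem_range] at hj
      refine Submodule.subset_span ⟨e ⟨⟨t, ht⟩, ⟨j, hj⟩⟩, ?_⟩
      funext r
      change gradedPart a (e.symm (e ⟨⟨t, ht⟩, ⟨j, hj⟩⟩)).2
        (e.symm (e ⟨⟨t, ht⟩, ⟨j, hj⟩⟩)).1.1 r = _
      rw [e.symm_apply_apply]

theorem IsGradedSubmodule.exists_minimal_homogeneous_generators {n : ℕ} {a : Fin n → ℕ}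
    {N : Submodule (MvPolynomial (Fin l) K) (Fin n → MvPolynomial (Fin l) K)}
    (hN : IsGradedSubmodule a N) :
    ∃ (m : ℕ) (b : Fin m → ℕ) (d : Matrix (Fin n) (Fin m) (MvPolynomial (Fin l) K)),
      IsGradedMatrix a b d ∧ LinearMap.range d.mulVecLin = N ∧
        ∀ v, d.mulVec v = 0 → ∀ c, constantCoeff (v c) = 0 := by
  classical
  have hex := hN.exists_homogeneous_generators
  obtain ⟨b, d, hd, hr⟩ := Nat.find_spec hex
  refine ⟨Nat.find hex, b, d, hd, hr, ?_⟩
  intro v hv c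
  by_contra hc
  obtain ⟨m', hm'⟩ : ∃ m', Nat.find hex = m' + 1 := ⟨Nat.find hex - 1, by have := c.pos; omega⟩
  refine Nat.find_min hex (m := m') (by omega) ?_
  generalize Nat.find hex = m at *
  subst hm'
  refine ⟨b ∘ c.succAbove, d.submatrix id c.succAbove, fun r k => hd r _, ?_⟩
  rw [← hr, Matrix.range_mulVecLin, Matrix.range_mulVecLin]
  apply le_antisymm
  · refine Submodule.span_mono ?_
    rintro _ ⟨k, rfl⟩
    exact ⟨c.succAbove k, rfl⟩
  · rw [Submodule.span_le]
    rintro _ ⟨k, rfl⟩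
    have hother : ∀ k, d.col (c.succAbove k) ∈ Submodule.span (MvPolynomial (Fin l) K)
        (Set.range (d.submatrix id c.succAbove).col) :=
      fun k => Submodule.subset_span ⟨k, rfl⟩
    induction k using c.succAboveCases with
    | p i => exact hother i
    | x =>
      have hw : d.mulVec (gradedPart b (b c) v) = 0 := by
        rw [hd.mulVec_gradedPart, hv, gradedPart_zero]
      have hwc : gradedPart b (b c) v c = C (constantCoeff (v c)) := by
        simp [gradedPart, constantCoeff_eq]
      generalize gradedPart b (b c) v = w at hw hwc
      have hsum : (C (constantCoeff (v c)) : MvPolynomial (Fin l) K) • d.col c +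
          ∑ k, w (c.succAbove k) • d.col (c.succAbove k) = 0 := by
        rw [← hwc, ← Fin.sum_univ_succAbove (fun k => w k • d.col k) c, ← hw]
        funext r
        simp [Matrix.mulVec, dotProduct, Matrix.col_apply, mul_comm]
      have hcol : d.col c = (C (constantCoeff (v c))⁻¹ : MvPolynomial (Fin l) K) •
          (C (constantCoeff (v c)) : MvPolynomial (Fin l) K) • d.col c := by
        rw [smul_smul, ← C_mul, inv_mul_cancel₀ hc, C_1, one_smul]
      rw [SetLike.mem_coe, hcol, eq_neg_of_add_eq_zero_left hsum]
      exact Submodule.smul_mem _ _ (Submodule.neg_mem _ (Submodule.sum_mem _ fun k _ =>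
        Submodule.smul_mem _ _ (hother k)))

end GradedVectors

section Existence

variable {K : Type*} [Field K] {l : ℕ}

/-- A graded submodule of a graded free module of finite rank. -/
structure GradedSyzygy (K : Type*) [Field K] (l : ℕ) where
  rank : ℕ
  deg : Fin rank → ℕ
  carrier : Submodule (MvPolynomial (Fin l) K) (Fin rank → MvPolynomial (Fin l) K)
  isGraded : IsGradedSubmodule deg carrier

namespace GradedSyzygy

/-- The number of minimal generators. -/
noncomputable def genRank (N : GradedSyzygy K l) : ℕ :=
  N.isGraded.exists_minimal_homogeneous_generators.choose

/-- The degrees of minimal generators. -/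
noncomputable def genDeg (N : GradedSyzygy K l) : Fin N.genRank → ℕ :=
  N.isGraded.exists_minimal_homogeneous_generators.choose_spec.choose

/-- The matrix whose columns are minimal homogeneous generators. -/
noncomputable def genMatrix (N : GradedSyzygy K l) :
    Matrix (Fin N.rank) (Fin N.genRank) (MvPolynomial (Fin l) K) :=
  N.isGraded.exists_minimal_homogeneous_generators.choose_spec.choose_spec.choose

theorem isGradedMatrix_genMatrix (N : GradedSyzygy K l) :
    IsGradedMatrix N.deg N.genDeg N.genMatrix :=
  N.isGraded.exists_minimal_homogeneous_generators.choose_spec.choose_spec.choose_spec.1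

theorem range_genMatrix (N : GradedSyzygy K l) :
    LinearMap.range N.genMatrix.mulVecLin = N.carrier :=
  N.isGraded.exists_minimal_homogeneous_generators.choose_spec.choose_spec.choose_spec.2.1

theorem constantCoeff_eq_zero (N : GradedSyzygy K l) {v : Fin N.genRank → MvPolynomial (Fin l) K}
    (hv : N.genMatrix.mulVec v = 0) (c : Fin N.genRank) : constantCoeff (v c) = 0 :=
  N.isGraded.exists_minimal_homogeneous_generators.choose_spec.choose_spec.choose_spec.2.2 v hv c

/-- The module of relations between the minimal generators. -/
noncomputable def next (N : GradedSyzygy K l) : GradedSyzygy K l where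
  rank := N.genRank
  deg := N.genDeg
  carrier := LinearMap.ker N.genMatrix.mulVecLin
  isGraded := N.isGradedMatrix_genMatrix.isGradedSubmodule_ker

/-- A homogeneous ideal, as a graded submodule of `S`. -/
noncomputable def ofIdeal (I : Ideal (MvPolynomial (Fin l) K))
    (hI : I.IsHomogeneous (homogeneousSubmodule (Fin l) K)) : GradedSyzygy K l where
  rank := 1
  deg := 0
  carrier := Submodule.comap (LinearMap.proj 0) I
  isGraded := by
    intro j v hv
    change gradedPart 0 j v 0 ∈ I
    change v 0 ∈ I at hv
    simpa [gradedPart] using homogeneousComponent_mem_of_mem hI hv j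

/-- The iterated syzygies of a homogeneous ideal. -/
noncomputable def iterate (I : Ideal (MvPolynomial (Fin l) K))
    (hI : I.IsHomogeneous (homogeneousSubmodule (Fin l) K)) : ℕ → GradedSyzygy K l
  | 0 => ofIdeal I hI
  | i + 1 => (iterate I hI i).next

theorem exact_next (N : GradedSyzygy K l) :
    Function.Exact N.next.genMatrix.mulVecLin N.genMatrix.mulVecLin := by
  intro v
  have h : v ∈ LinearMap.range N.next.genMatrix.mulVecLin ↔ v ∈ N.next.carrier := by
    rw [range_genMatrix]
  exact h.symm

theorem constantCoeff_genMatrix_next (N : GradedSyzygy K l) (r : Fin N.next.rank)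
    (c : Fin N.next.genRank) : constantCoeff (N.next.genMatrix r c) = 0 := by
  have hmem : N.next.genMatrix.col c ∈ N.next.carrier := by
    rw [← range_genMatrix, Matrix.range_mulVecLin]
    exact Submodule.subset_span ⟨c, rfl⟩
  exact N.constantCoeff_eq_zero hmem r

end GradedSyzygy

theorem nonempty_minimalGradedFreeResolution (I : Ideal (MvPolynomial (Fin l) K))
    (hI : I.IsHomogeneous (homogeneousSubmodule (Fin l) K)) :
    Nonempty (MinimalGradedFreeResolution I) := by
  let Z := GradedSyzygy.iterate I hI
  have hrange := (Z 0).range_genMatrix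
  refine ⟨{
    rank := fun i => (Z i).genRank
    deg := fun i => (Z i).genDeg
    gen := fun k => (Z 0).genMatrix (0 : Fin 1) k
    d := fun i => (Z (i + 1)).genMatrix
    gen_homogeneous := ?_
    d_homogeneous := fun i => (Z (i + 1)).isGradedMatrix_genMatrix
    span_gen := ?_
    exact_zero := ?_
    exact_succ := fun i => (Z (i + 1)).exact_next
    minimal := fun i => (Z i).constantCoeff_genMatrix_next }⟩
  · intro k
    rcases (Z 0).isGradedMatrix_genMatrix (0 : Fin 1) k with h | ⟨n, hn, h⟩
    · rw [h]
      exact isHomogeneous_zero _ _ _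
    · rw [← hn]
      change IsHomogeneous _ (0 + n)
      rwa [zero_add]
  · ext f
    have hf : f ∈ I ↔ (fun _ => f) ∈ LinearMap.range (Z 0).genMatrix.mulVecLin := by
      rw [hrange]
      rfl
    rw [hf, Ideal.span, ← Fintype.range_linearCombination, LinearMap.mem_range, LinearMap.mem_range]
    refine exists_congr fun v => ?_
    rw [Matrix.mulVecLin_apply, funext_iff]
    constructor
    · intro h r
      rw [← h, show r = (0 : Fin 1) from Subsingleton.elim (α := Fin 1) _ _]
      simp [Matrix.mulVec, dotProduct, Fintype.linearCombination_apply, mul_comm]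
    · intro h
      rw [← h (0 : Fin 1)]
      simp [Matrix.mulVec, dotProduct, Fintype.linearCombination_apply, mul_comm]
  · intro v
    refine Iff.trans ?_ ((Z 0).exact_next v)
    rw [Matrix.mulVecLin_apply, funext_iff]
    constructor
    · intro h r
      rw [Pi.zero_apply, ← h, show r = (0 : Fin 1) from Subsingleton.elim (α := Fin 1) _ _]
      simp [Matrix.mulVec, dotProduct, Fintype.linearCombination_apply, mul_comm]
    · intro h
      rw [← show _ = (0 : MvPolynomial (Fin l) K) from h (0 : Fin 1)]
      simp [Matrix.mulVec, dotProduct, Fintype.linearCombination_apply, mul_comm]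

end Existence

end Lefschetz

namespace Lefschetz

open MvPolynomial

section Hyperplane

variable {K : Type*} [Field K] {l : ℕ}

/-- The restriction to the hyperplane `x_0 = 0`. -/
noncomputable def restrictHyperplane (K : Type*) [Field K] (l : ℕ) :
    MvPolynomial (Fin (l + 1)) K →ₐ[K] MvPolynomial (Fin l) K :=
  aeval (Fin.cons 0 X : Fin (l + 1) → MvPolynomial (Fin l) K)

theorem restrictHyperplane_X_zero : restrictHyperplane K l (X 0) = 0 := by
  simp [restrictHyperplane]

theorem restrictHyperplane_X_succ (i : Fin l) : restrictHyperplane K l (X i.succ) = X i := by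
  simp [restrictHyperplane]

theorem restrictHyperplane_rename (f : MvPolynomial (Fin l) K) :
    restrictHyperplane K l (rename Fin.succ f) = f := by
  have h : (restrictHyperplane K l).comp (rename Fin.succ) = AlgHom.id K _ := by
    ext i
    simp [restrictHyperplane]
  exact DFunLike.congr_fun h f

theorem X_zero_dvd_of_restrictHyperplane_eq_zero {f : MvPolynomial (Fin (l + 1)) K}
    (hf : restrictHyperplane K l f = 0) : X 0 ∣ f := by
  have h : (Ideal.Quotient.mkₐ K (Ideal.span {(X 0 : MvPolynomial (Fin (l + 1)) K)})).comp
      ((rename Fin.succ).comp (restrictHyperplane K l)) = Ideal.Quotient.mkₐ K _ := by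
    apply algHom_ext
    intro i
    induction i using Fin.cases with
    | zero =>
      rw [AlgHom.comp_apply, AlgHom.comp_apply, restrictHyperplane_X_zero, map_zero, map_zero,
        Ideal.Quotient.mkₐ_eq_mk, eq_comm, Ideal.Quotient.eq_zero_iff_mem]
      exact Ideal.mem_span_singleton_self _
    | succ i => simp [restrictHyperplane_X_succ]
  have h' := DFunLike.congr_fun h f
  rw [AlgHom.comp_apply, AlgHom.comp_apply, hf, map_zero, map_zero,
    Ideal.Quotient.mkₐ_eq_mk, eq_comm, Ideal.Quotient.eq_zero_iff_mem,
    Ideal.mem_span_singleton] at h'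
  exact h'

theorem isHomogeneous_restrictHyperplane {f : MvPolynomial (Fin (l + 1)) K} {n : ℕ}
    (hf : f.IsHomogeneous n) : (restrictHyperplane K l f).IsHomogeneous n := by
  have h := hf.aeval (n := 1) (Fin.cons 0 X : Fin (l + 1) → MvPolynomial (Fin l) K) (by
    intro i
    induction i using Fin.cases with
    | zero => exact isHomogeneous_zero _ _ _
    | succ i => exact isHomogeneous_X _ _)
  rwa [one_mul] at h

theorem constantCoeff_restrictHyperplane (f : MvPolynomial (Fin (l + 1)) K) :
    constantCoeff (restrictHyperplane K l f) = constantCoeff f := by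
  have h : (constantCoeff (R := K)).comp (restrictHyperplane K l).toRingHom = constantCoeff := by
    apply ringHom_ext
    · intro r
      simp [restrictHyperplane]
    · intro i
      induction i using Fin.cases with
      | zero => simp [restrictHyperplane]
      | succ i => simp [restrictHyperplane]
  exact DFunLike.congr_fun h f

theorem restrictHyperplane_comp_mulVec {m n : ℕ}
    (A : Matrix (Fin m) (Fin n) (MvPolynomial (Fin (l + 1)) K))
    (v : Fin n → MvPolynomial (Fin (l + 1)) K) :
    restrictHyperplane K l ∘ A.mulVec v =
      (A.map (restrictHyperplane K l)).mulVec (restrictHyperplane K l ∘ v) := by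
  funext r
  exact RingHom.map_mulVec (restrictHyperplane K l).toRingHom A v r

theorem exists_smul_eq_of_restrictHyperplane_comp_eq_zero {n : ℕ}
    {v : Fin n → MvPolynomial (Fin (l + 1)) K} (hv : restrictHyperplane K l ∘ v = 0) :
    ∃ w : Fin n → MvPolynomial (Fin (l + 1)) K, v = (X 0 : MvPolynomial (Fin (l + 1)) K) • w := by
  choose w hw using fun k => X_zero_dvd_of_restrictHyperplane_eq_zero (congrFun hv k)
  exact ⟨w, funext hw⟩

theorem restrictHyperplane_comp_X_zero_smul {n : ℕ} (v : Fin n → MvPolynomial (Fin (l + 1)) K) :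
    restrictHyperplane K l ∘ ((X 0 : MvPolynomial (Fin (l + 1)) K) • v) = 0 := by
  funext k
  simp [restrictHyperplane_X_zero]

theorem X_zero_smul_injective {n : ℕ} {v w : Fin n → MvPolynomial (Fin (l + 1)) K}
    (h : (X 0 : MvPolynomial (Fin (l + 1)) K) • v = (X 0 : MvPolynomial (Fin (l + 1)) K) • w) :
    v = w := by
  funext k
  exact mul_left_cancel₀ (X_ne_zero 0) (congrFun h k)

theorem exists_restrictHyperplane_comp_eq {n : ℕ} (v : Fin n → MvPolynomial (Fin l) K) :
    ∃ w : Fin n → MvPolynomial (Fin (l + 1)) K, restrictHyperplane K l ∘ w = v := by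
  refine ⟨fun k => rename Fin.succ (v k), ?_⟩
  funext k
  rw [Function.comp_apply, restrictHyperplane_rename]

/-- Exactness at three consecutive places survives modulo `x_0`, because `x_0` is a
nonzerodivisor on the image of `A`. -/
theorem exact_map_restrictHyperplane {m n p q : ℕ}
    {A : Matrix (Fin m) (Fin n) (MvPolynomial (Fin (l + 1)) K)}
    {B : Matrix (Fin n) (Fin p) (MvPolynomial (Fin (l + 1)) K)}
    {C : Matrix (Fin p) (Fin q) (MvPolynomial (Fin (l + 1)) K)}
    (hAB : Function.Exact B.mulVecLin A.mulVecLin) (hBC : Function.Exact C.mulVecLin B.mulVecLin) :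
    Function.Exact (C.map (restrictHyperplane K l)).mulVecLin
      (B.map (restrictHyperplane K l)).mulVecLin := by
  intro f
  obtain ⟨f, rfl⟩ := exists_restrictHyperplane_comp_eq f
  rw [Matrix.mulVecLin_apply, ← restrictHyperplane_comp_mulVec]
  constructor
  · intro hf
    obtain ⟨g, hg⟩ := exists_smul_eq_of_restrictHyperplane_comp_eq_zero hf
    have hAg : A.mulVecLin g = 0 := by
      apply X_zero_smul_injective
      rw [← map_smul, ← hg, smul_zero]
      exact hAB.apply_apply_eq_zero f
    obtain ⟨h, rfl⟩ := (hAB g).1 hAg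
    have hker : B.mulVecLin (f - (X 0 : MvPolynomial (Fin (l + 1)) K) • h) = 0 := by
      rw [map_sub, map_smul, ← hg, Matrix.mulVecLin_apply, sub_self]
    obtain ⟨w, hw⟩ := (hBC _).1 hker
    refine ⟨restrictHyperplane K l ∘ w, ?_⟩
    rw [Matrix.mulVecLin_apply, ← restrictHyperplane_comp_mulVec, ← Matrix.mulVecLin_apply, hw]
    funext k
    simp [restrictHyperplane_X_zero]
  · rintro ⟨w, hw⟩
    obtain ⟨w, rfl⟩ := exists_restrictHyperplane_comp_eq w
    rw [Matrix.mulVecLin_apply, ← restrictHyperplane_comp_mulVec] at hw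
    obtain ⟨g, hg⟩ := exists_smul_eq_of_restrictHyperplane_comp_eq_zero
      (v := f - C.mulVec w) (by
        funext k
        have := congrFun hw k
        simp only [Function.comp_apply] at this
        simp [this])
    have hf : f = C.mulVecLin w + (X 0 : MvPolynomial (Fin (l + 1)) K) • g := by
      rw [← hg, Matrix.mulVecLin_apply, add_sub_cancel]
    rw [← Matrix.mulVecLin_apply, hf, map_add, hBC.apply_apply_eq_zero, map_smul, zero_add]
    exact restrictHyperplane_comp_X_zero_smul _

end Hyperplane

section Syzygies

variable {K : Type*} [Field K]

/-- Hilbert's syzygy theorem for minimal complexes of free modules. -/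
theorem rank_eq_zero_of_exact_of_minimal {l : ℕ} (rank : ℕ → ℕ)
    (d : (i : ℕ) → Matrix (Fin (rank i)) (Fin (rank (i + 1))) (MvPolynomial (Fin l) K))
    (hd : ∀ i, Function.Exact (d (i + 1)).mulVecLin (d i).mulVecLin)
    (hmin : ∀ i r c, constantCoeff (d (i + 1) r c) = 0) (i : ℕ) (hi : l + 2 ≤ i) :
    rank i = 0 := by
  induction l generalizing rank i with
  | zero =>
    obtain ⟨i, rfl⟩ : ∃ j, i = j + 2 := ⟨i - 2, by omega⟩
    have hzero : ∀ i, d (i + 1) = 0 := by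
      intro i
      ext1 r c
      rw [eq_C_of_isEmpty (d (i + 1) r c), ← constantCoeff_eq, hmin, C_0]
      rfl
    by_contra h
    let k : Fin (rank (i + 2)) := ⟨0, by omega⟩
    obtain ⟨w, hw⟩ := (hd (i + 1) (Pi.single k 1)).1 (by simp [hzero])
    rw [hzero (i + 1)] at hw
    have := congrFun hw k
    simp at this
  | succ l ih =>
    obtain ⟨i, rfl⟩ : ∃ j, i = j + 1 := ⟨i - 1, by omega⟩
    refine ih (fun i => rank (i + 1)) (fun i => (d (i + 1)).map (restrictHyperplane K l))
      (fun i => exact_map_restrictHyperplane (hd i) (hd (i + 1))) ?_ i (by omega)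
    intro i r c
    rw [Matrix.map_apply, constantCoeff_restrictHyperplane, hmin]

/-- A socle element of degree `j` of the cokernel of `d 0` forces a generator of degree `j + l`
in homological degree `l`. -/
theorem exists_deg_eq_of_socle {l : ℕ} (rank : ℕ → ℕ) (deg : (i : ℕ) → Fin (rank i) → ℕ)
    (d : (i : ℕ) → Matrix (Fin (rank i)) (Fin (rank (i + 1))) (MvPolynomial (Fin l) K))
    (hdeg : ∀ i, IsGradedMatrix (deg i) (deg (i + 1)) (d i))
    (hd : ∀ i, Function.Exact (d (i + 1)).mulVecLin (d i).mulVecLin)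
    (j : ℕ) (u : Fin (rank 0) → MvPolynomial (Fin l) K) (hu : IsGradedVector (deg 0) j u)
    (hmem : u ∉ LinearMap.range (d 0).mulVecLin)
    (hsocle : ∀ i, (X i : MvPolynomial (Fin l) K) • u ∈ LinearMap.range (d 0).mulVecLin) :
    ∃ k, deg l k = j + l := by
  induction l generalizing rank j with
  | zero =>
    have hu0 : u ≠ 0 := by
      rintro rfl
      exact hmem (zero_mem _)
    obtain ⟨k, hk⟩ := Function.ne_iff.1 hu0
    refine ⟨k, ?_⟩
    rcases hu k with h | ⟨m, hm, h⟩
    · exact absurd h hk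
    · have := h.inj_right (isHomogeneous_of_isEmpty _ _ (u k)) hk
      omega
  | succ l ih =>
    obtain ⟨v, hv, hvu⟩ : ∃ v, IsGradedVector (deg 1) (j + 1) v ∧
        (d 0).mulVecLin v = (X 0 : MvPolynomial (Fin (l + 1)) K) • u := by
      obtain ⟨v, hv⟩ := hsocle 0
      refine ⟨gradedPart (deg 1) (j + 1) v, isGradedVector_gradedPart _ _ _, ?_⟩
      rw [Matrix.mulVecLin_apply] at hv ⊢
      rw [(hdeg 0).mulVec_gradedPart, hv]
      apply IsGradedVector.gradedPart_eq
      intro k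
      rcases hu k with h | ⟨m, hm, h⟩
      · exact Or.inl (by simp [h])
      · refine Or.inr ⟨1 + m, by omega, ?_⟩
        exact (isHomogeneous_X K 0).mul h
    have key := ih (fun i => rank (i + 1)) (fun i => deg (i + 1))
      (fun i => (d (i + 1)).map (restrictHyperplane K l)) ?_
      (fun i => exact_map_restrictHyperplane (hd i) (hd (i + 1))) (j + 1)
      (restrictHyperplane K l ∘ v) ?_ ?_ ?_
    · obtain ⟨k, hk⟩ := key
      exact ⟨k, by omega⟩
    · intro i r c
      rw [Matrix.map_apply]
      rcases hdeg (i + 1) r c with h | ⟨n, hn, h⟩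
      · exact Or.inl (by rw [h, map_zero])
      · exact Or.inr ⟨n, hn, isHomogeneous_restrictHyperplane h⟩
    · intro k
      rcases hv k with h | ⟨n, hn, h⟩
      · exact Or.inl (by rw [Function.comp_apply, h, map_zero])
      · exact Or.inr ⟨n, hn, isHomogeneous_restrictHyperplane h⟩
    · rintro ⟨w, hw⟩
      obtain ⟨w, rfl⟩ := exists_restrictHyperplane_comp_eq w
      rw [Matrix.mulVecLin_apply, ← restrictHyperplane_comp_mulVec] at hw
      obtain ⟨z, hz⟩ := exists_smul_eq_of_restrictHyperplane_comp_eq_zero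
        (v := v - (d 1).mulVec w) (by
          funext k
          have := congrFun hw k
          simp only [Function.comp_apply] at this
          simp [this])
      refine hmem ⟨z, X_zero_smul_injective ?_⟩
      rw [← map_smul, ← hz, map_sub, hvu, ← Matrix.mulVecLin_apply, (hd 0).apply_apply_eq_zero,
        sub_zero]
    · intro i
      obtain ⟨z, hz⟩ := hsocle i.succ
      have hker : (d 0).mulVecLin ((X i.succ : MvPolynomial (Fin (l + 1)) K) • v -
          (X 0 : MvPolynomial (Fin (l + 1)) K) • z) = 0 := by
        rw [map_sub, map_smul, map_smul, hz, hvu, smul_comm, sub_self]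
      obtain ⟨w, hw⟩ := (hd 0 _).1 hker
      refine ⟨restrictHyperplane K l ∘ w, ?_⟩
      rw [Matrix.mulVecLin_apply, ← restrictHyperplane_comp_mulVec, ← Matrix.mulVecLin_apply, hw]
      funext k
      simp [restrictHyperplane_X_zero, restrictHyperplane_X_succ]

end Syzygies

section Resolution

variable {K : Type*} [Field K] {l : ℕ} {I : Ideal (MvPolynomial (Fin l) K)}

namespace MinimalGradedFreeResolution

/-- The ranks of the resolution `⋯ → F_1 → F_0 → S` of `S/I`. -/
def augRank (F : MinimalGradedFreeResolution I) : ℕ → ℕ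
  | 0 => 1
  | i + 1 => F.rank i

/-- The degrees of the resolution `⋯ → F_1 → F_0 → S` of `S/I`. -/
def augDeg (F : MinimalGradedFreeResolution I) : (i : ℕ) → Fin (F.augRank i) → ℕ
  | 0 => fun _ => 0
  | i + 1 => F.deg i

/-- The maps of the resolution `⋯ → F_1 → F_0 → S` of `S/I`. -/
def augMatrix (F : MinimalGradedFreeResolution I) :
    (i : ℕ) → Matrix (Fin (F.augRank i)) (Fin (F.augRank (i + 1))) (MvPolynomial (Fin l) K)
  | 0 => Matrix.of fun _ k => F.gen k
  | i + 1 => F.d i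

theorem augMatrix_zero_mulVec (F : MinimalGradedFreeResolution I)
    (v : Fin (F.rank 0) → MvPolynomial (Fin l) K) :
    (F.augMatrix 0).mulVecLin v =
      fun _ => Fintype.linearCombination (MvPolynomial (Fin l) K) F.gen v := by
  funext r
  change ∑ k, F.gen k * v k = _
  simp [Fintype.linearCombination_apply, mul_comm]

theorem exact_augMatrix (F : MinimalGradedFreeResolution I) (i : ℕ) :
    Function.Exact (F.augMatrix (i + 1)).mulVecLin (F.augMatrix i).mulVecLin := by
  cases i with
  | zero =>
    intro v
    refine Iff.trans ?_ (F.exact_zero v)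
    have hv := F.augMatrix_zero_mulVec v
    exact ⟨fun h => congrFun (hv.symm.trans h) (0 : Fin 1), fun h => hv.trans (funext fun _ => h)⟩
  | succ i => exact F.exact_succ i

theorem isGradedMatrix_augMatrix (F : MinimalGradedFreeResolution I) (i : ℕ) :
    IsGradedMatrix (F.augDeg i) (F.augDeg (i + 1)) (F.augMatrix i) := by
  cases i with
  | zero => exact fun r c => Or.inr ⟨F.deg 0 c, zero_add _, F.gen_homogeneous c⟩
  | succ i => exact F.d_homogeneous i

theorem mem_range_augMatrix_zero (F : MinimalGradedFreeResolution I) (f : MvPolynomial (Fin l) K) :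
    (fun _ => f) ∈ LinearMap.range (F.augMatrix 0).mulVecLin ↔ f ∈ I := by
  have hI : f ∈ I ↔
      f ∈ LinearMap.range (Fintype.linearCombination (MvPolynomial (Fin l) K) F.gen) := by
    rw [Fintype.range_linearCombination, ← Ideal.span, F.span_gen]
  rw [hI]
  constructor
  · rintro ⟨v, hv⟩
    exact ⟨v, congrFun ((F.augMatrix_zero_mulVec v).symm.trans hv) (0 : Fin 1)⟩
  · rintro ⟨v, rfl⟩
    exact ⟨v, augMatrix_zero_mulVec F v⟩

theorem rank_eq_zero (F : MinimalGradedFreeResolution I) {i : ℕ} (hi : l + 1 ≤ i) :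
    F.rank i = 0 :=
  rank_eq_zero_of_exact_of_minimal F.augRank F.augMatrix F.exact_augMatrix F.minimal (i + 1)
    (by omega)

theorem exists_deg_eq (F : MinimalGradedFreeResolution I) {j : ℕ} {u : MvPolynomial (Fin l) K}
    (hu : u.IsHomogeneous j) (hmem : u ∉ I) (hsocle : ∀ i, X i * u ∈ I) (hl : l ≠ 0) :
    ∃ k, F.deg (l - 1) k = j + l := by
  have h := exists_deg_eq_of_socle F.augRank F.augDeg F.augMatrix F.isGradedMatrix_augMatrix
    F.exact_augMatrix j (fun _ => u) (fun _ => Or.inr ⟨j, zero_add j, hu⟩)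
    (by rwa [mem_range_augMatrix_zero]) (fun i => (F.mem_range_augMatrix_zero _).2 (hsocle i))
  obtain ⟨i, hi⟩ : ∃ i, l = i + 1 := ⟨l - 1, by omega⟩
  have aux : ∀ m, m = i + 1 → (∃ k, F.augDeg m k = j + l) → ∃ k, F.deg (m - 1) k = j + l := by
    rintro m rfl h
    exact h
  exact aux l hi h

end MinimalGradedFreeResolution

open Classical in
theorem exists_resolution_gradedBetti_ne_zero_iff
    (hI : I.IsHomogeneous (homogeneousSubmodule (Fin l) K)) :
    ∃ F : MinimalGradedFreeResolution I,
      ∀ i j, gradedBetti I i j ≠ 0 ↔ ∃ k, F.deg i k = j := by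
  have h := nonempty_minimalGradedFreeResolution I hI
  refine ⟨h.some, fun i j => ?_⟩
  rw [gradedBetti, dif_pos h, Finset.card_ne_zero]
  simp [Finset.Nonempty]

theorem bddAbove_regularitySet (hI : I.IsHomogeneous (homogeneousSubmodule (Fin l) K)) :
    BddAbove (regularitySet I) := by
  obtain ⟨F, hF⟩ := exists_resolution_gradedBetti_ne_zero_iff hI
  have hfin : (Set.range fun p : Σ i : Fin (l + 1), Fin (F.rank i) =>
      ((F.deg p.1 p.2 : ℤ) - (p.1 : ℕ))).Finite := Set.finite_range _
  refine hfin.bddAbove.mono ?_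
  rintro _ ⟨i, j, hij, rfl⟩
  obtain ⟨k, rfl⟩ := (hF i j).1 hij
  have hi : i < l + 1 := by
    by_contra hi
    have := F.rank_eq_zero (i := i) (by omega)
    have := k.pos
    omega
  exact ⟨⟨⟨i, hi⟩, k⟩, rfl⟩

theorem isGreatest_regularity (hI : I.IsHomogeneous (homogeneousSubmodule (Fin l) K))
    (hne : I ≠ ⊥) : IsGreatest (regularitySet I) (regularity I) := by
  refine ⟨Int.csSup_mem ?_ (bddAbove_regularitySet hI),
    fun r hr => le_csSup (bddAbove_regularitySet hI) hr⟩
  obtain ⟨F, hF⟩ := exists_resolution_gradedBetti_ne_zero_iff hI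
  have hrank : 0 < F.rank 0 := by
    by_contra h
    have : IsEmpty (Fin (F.rank 0)) := by
      rw [show F.rank 0 = 0 by omega]
      infer_instance
    apply hne
    rw [← F.span_gen, Set.range_eq_empty, Ideal.span_empty]
  exact ⟨_, 0, _, (hF 0 _).2 ⟨⟨0, hrank⟩, rfl⟩, rfl⟩

theorem degree_socle_lt_regularity (hI : I.IsHomogeneous (homogeneousSubmodule (Fin l) K))
    (hl : l ≠ 0) {j : ℕ} {u : MvPolynomial (Fin l) K}
    (hu : u.IsHomogeneous j) (hmem : u ∉ I) (hsocle : ∀ i, X i * u ∈ I) :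
    (j : ℤ) < regularity I := by
  obtain ⟨F, hF⟩ := exists_resolution_gradedBetti_ne_zero_iff hI
  obtain ⟨k, hk⟩ := F.exists_deg_eq hu hmem hsocle hl
  have : (j : ℤ) + 1 ≤ regularity I := by
    refine le_csSup (bddAbove_regularitySet hI) ⟨l - 1, j + l, (hF _ _).2 ⟨k, hk⟩, ?_⟩
    omega
  omega

end Resolution

end Lefschetz

namespace Lefschetz

open MvPolynomial

section Perturbation

variable {K V W : Type*} [Field K] [AddCommGroup V] [Module K V] [AddCommGroup W] [Module K W]

theorem finite_not_bijective_id_add_smul [FiniteDimensional K V] (T : V →ₗ[K] V) :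
    {s : K | ¬ Function.Bijective (LinearMap.id + s • T : V →ₗ[K] V)}.Finite := by
  have hinj : Function.Injective fun s : K => -s⁻¹ := fun s t h => inv_injective (neg_injective h)
  refine ((Module.End.finite_hasEigenvalue T).preimage hinj.injOn).subset ?_
  intro s hs
  have hs' : ¬ Function.Injective (LinearMap.id + s • T : V →ₗ[K] V) :=
    fun h => hs ⟨h, LinearMap.injective_iff_surjective.1 h⟩
  rw [← LinearMap.ker_eq_bot, Submodule.eq_bot_iff] at hs'
  push Not at hs'
  obtain ⟨v, hv, hv0⟩ := hs'
  rw [LinearMap.mem_ker, LinearMap.add_apply, LinearMap.id_apply, LinearMap.smul_apply] at hv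
  have hs0 : s ≠ 0 := by
    rintro rfl
    rw [zero_smul, add_zero] at hv
    exact hv0 hv
  refine Module.End.hasEigenvalue_of_hasEigenvector (x := v)
    ⟨Module.End.mem_eigenspace_iff.2 ?_, hv0⟩
  have h : v = -(s • T v) := eq_neg_of_add_eq_zero_left hv
  conv_rhs => rw [h]
  rw [smul_neg, neg_smul, neg_neg, smul_smul, inv_mul_cancel₀ hs0, one_smul]

theorem FullRank.finite_not_fullRank_add_smul [FiniteDimensional K V] [FiniteDimensional K W]
    {f : V →ₗ[K] W} (hf : FullRank f) (g : V →ₗ[K] W) :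
    {s : K | ¬ FullRank (f + s • g)}.Finite := by
  rcases hf with hf | hf
  · obtain ⟨h, hh⟩ := f.exists_leftInverse_of_injective (LinearMap.ker_eq_bot.2 hf)
    refine (finite_not_bijective_id_add_smul (h ∘ₗ g)).subset fun s hs hbij => hs (Or.inl ?_)
    have heq : LinearMap.id + s • (h ∘ₗ g) = h ∘ₗ (f + s • g) := by
      rw [LinearMap.comp_add, LinearMap.comp_smul, hh]
    rw [heq, LinearMap.coe_comp] at hbij
    exact hbij.1.of_comp
  · obtain ⟨h, hh⟩ := f.exists_rightInverse_of_surjective (LinearMap.range_eq_top.2 hf)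
    refine (finite_not_bijective_id_add_smul (g ∘ₗ h)).subset fun s hs hbij => hs (Or.inr ?_)
    have heq : LinearMap.id + s • (g ∘ₗ h) = (f + s • g) ∘ₗ h := by
      rw [LinearMap.add_comp, LinearMap.smul_comp, hh]
    rw [heq, LinearMap.coe_comp] at hbij
    exact hbij.2.of_comp

end Perturbation

section LinearForms

variable {K : Type*} [Field K] {l : ℕ} {I : Ideal (MvPolynomial (Fin l) K)}

/-- The associated primes of `S/I` that do not contain `(x_1, …, x_l)`. -/
def relevantPrimes (I : Ideal (MvPolynomial (Fin l) K)) : Set (Ideal (MvPolynomial (Fin l) K)) :=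
  {P | IsAssociatedPrime P (MvPolynomial (Fin l) K ⧸ I) ∧ ∃ i, X i ∉ P}

theorem finite_relevantPrimes (I : Ideal (MvPolynomial (Fin l) K)) : (relevantPrimes I).Finite :=
  (associatedPrimes.finite (MvPolynomial (Fin l) K) (MvPolynomial (Fin l) K ⧸ I)).subset
    fun _ hP => hP.1

theorem exists_linearForm_notMem_relevantPrimes [Infinite K]
    (I : Ideal (MvPolynomial (Fin l) K)) :
    ∃ f : MvPolynomial (Fin l) K, f.IsHomogeneous 1 ∧ ∀ P ∈ relevantPrimes I, f ∉ P := by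
  classical
  let E := homogeneousSubmodule (Fin l) K 1
  let V : Ideal (MvPolynomial (Fin l) K) → Subspace K E := fun P =>
    (P.restrictScalars K).comap E.subtype
  have hV : ⊤ ∉ (finite_relevantPrimes I).toFinset.image V := by
    rw [Finset.mem_image]
    rintro ⟨P, hP, hPV⟩
    rw [Set.Finite.mem_toFinset] at hP
    obtain ⟨i, hi⟩ := hP.2
    have : (⟨X i, isHomogeneous_X K i⟩ : E) ∈ V P := hPV ▸ Submodule.mem_top
    exact hi this
  obtain ⟨f, hf⟩ := (Set.ne_univ_iff_exists_notMem _).1 (Subspace.biUnion_ne_univ_of_top_notMem hV)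
  refine ⟨f, f.2, fun P hP hfP => hf ?_⟩
  simp only [Set.mem_iUnion]
  exact ⟨V P, Finset.mem_image_of_mem _ ((finite_relevantPrimes I).mem_toFinset.2 hP), hfP⟩

theorem finite_add_smul_mem_relevantPrimes (f₀ : MvPolynomial (Fin l) K)
    {f₁ : MvPolynomial (Fin l) K} (hf₁ : ∀ P ∈ relevantPrimes I, f₁ ∉ P) :
    {s : K | ∃ P ∈ relevantPrimes I, f₀ + s • f₁ ∈ P}.Finite := by
  have h : {s : K | ∃ P ∈ relevantPrimes I, f₀ + s • f₁ ∈ P} =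
      ⋃ P ∈ relevantPrimes I, {s : K | f₀ + s • f₁ ∈ P} := by
    ext s
    simp
  rw [h]
  refine (finite_relevantPrimes I).biUnion fun P hP => Set.Subsingleton.finite ?_
  intro s hs t ht
  by_contra hst
  apply hf₁ P hP
  have hmem : (s - t) • f₁ ∈ P.restrictScalars K := by
    have := P.sub_mem hs ht
    rwa [add_sub_add_left_eq_sub, ← sub_smul] at this
  have := (P.restrictScalars K).smul_mem (s - t)⁻¹ hmem
  rwa [smul_smul, inv_mul_cancel₀ (sub_ne_zero.2 hst), one_smul] at this

/-- A form killed modulo `I` by a linear form outside the relevant primes has a multiple that is a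
socle element of `S/I`. -/
theorem exists_socle_of_mul_mem (hI : I.IsHomogeneous (homogeneousSubmodule (Fin l) K))
    {f u : MvPolynomial (Fin l) K} (hf : ∀ P ∈ relevantPrimes I, f ∉ P) {i : ℕ}
    (hu : u.IsHomogeneous i) (hmem : u ∉ I) (hfu : f * u ∈ I) :
    ∃ j ≥ i, ∃ w : MvPolynomial (Fin l) K, w.IsHomogeneous j ∧ w ∉ I ∧ ∀ k, X k * w ∈ I := by
  let N : Submodule (MvPolynomial (Fin l) K) (MvPolynomial (Fin l) K ⧸ I) :=
    Submodule.span _ {Ideal.Quotient.mk I u}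
  let x : N := ⟨Ideal.Quotient.mk I u, Submodule.mem_span_singleton_self _⟩
  have hx : x ≠ 0 := fun h => hmem (Ideal.Quotient.eq_zero_iff_mem.1 (congrArg Subtype.val h))
  obtain ⟨P, hP, hle⟩ :=
    exists_le_isAssociatedPrime_of_isNoetherianRing (MvPolynomial (Fin l) K) x hx
  have hfP : f ∈ P := by
    apply hle
    rw [Submodule.mem_colon_singleton, Submodule.mem_bot]
    exact Subtype.ext (Ideal.Quotient.eq_zero_iff_mem.2 hfu)
  have hXP : ∀ k, X k ∈ P := by
    by_contra! h
    exact hf P ⟨hP.map_of_injective N.subtype N.injective_subtype, h⟩ hfP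
  obtain ⟨hprime, ⟨y, hy⟩, hPy⟩ := isAssociatedPrime_iff.1 hP
  obtain ⟨g, rfl⟩ := Submodule.mem_span_singleton.1 hy
  have hiff : ∀ p, p ∈ P ↔ p * (g * u) ∈ I := by
    intro p
    rw [hPy, Submodule.mem_colon_singleton, Submodule.mem_bot, ← Ideal.Quotient.eq_zero_iff_mem,
      Subtype.ext_iff]
    rfl
  have hgu : g * u ∉ I := by
    intro h
    apply hprime.ne_top
    rw [Ideal.eq_top_iff_one, hiff, one_mul]
    exact h
  rw [mem_iff_homogeneousComponent_mem hI] at hgu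
  push Not at hgu
  obtain ⟨n, hn⟩ := hgu
  refine ⟨n, ?_, _, homogeneousComponent_isHomogeneous n (g * u), hn, ?_⟩
  · by_contra hlt
    apply hn
    rw [mul_comm, homogeneousComponent_mul_eq_zero_of_isHomogeneous hu _ (by omega)]
    exact zero_mem _
  · intro k
    rw [← homogeneousComponent_mul_of_isHomogeneous (isHomogeneous_X K k)]
    exact homogeneousComponent_mem_of_mem hI ((hiff _).1 (hXP k)) _

theorem injective_mulMap_of_regularity_le
    (hI : I.IsHomogeneous (homogeneousSubmodule (Fin l) K)) (hl : l ≠ 0)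
    {f : MvPolynomial (Fin l) K} (hf : ∀ P ∈ relevantPrimes I, f ∉ P)
    (ℓ : quotientGrading I 1) (hℓ : (ℓ : MvPolynomial (Fin l) K ⧸ I) = Ideal.Quotient.mk I f)
    {i : ℕ} (hi : regularity I ≤ i) : Function.Injective (mulMap (quotientGrading I) ℓ i) := by
  rw [← LinearMap.ker_eq_bot, Submodule.eq_bot_iff]
  rintro ⟨_, u, hu, rfl⟩ hker
  have hfu : f * u ∈ I := by
    rw [← Ideal.Quotient.eq_zero_iff_mem, map_mul, ← hℓ]
    exact congrArg Subtype.val hker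
  have hmem : u ∈ I := by
    by_contra hmem
    obtain ⟨j, hj, w, hw, hwI, hsocle⟩ := exists_socle_of_mul_mem hI hf hu hmem hfu
    have := degree_socle_lt_regularity hI hl hw hwI hsocle
    omega
  exact Subtype.ext (Ideal.Quotient.eq_zero_iff_mem.2 hmem)

instance finiteDimensional_quotientGrading (i : ℕ) :
    FiniteDimensional K (quotientGrading I i) :=
  Module.Finite.iff_fg.2 ((homogeneousSubmodule_fg (Fin l) K i).map _)

theorem mulMap_add_smul (ℓ₀ ℓ₁ : quotientGrading I 1) (s : K) (i : ℕ) :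
    mulMap (quotientGrading I) (ℓ₀ + s • ℓ₁) i =
      mulMap (quotientGrading I) ℓ₀ i + s • mulMap (quotientGrading I) ℓ₁ i := by
  ext x
  change ((ℓ₀ : MvPolynomial (Fin l) K ⧸ I) + s • (ℓ₁ : MvPolynomial (Fin l) K ⧸ I)) * x =
    ℓ₀ * x + s • (ℓ₁ * x)
  rw [add_mul, smul_mul_assoc]

theorem fullRank_mulMap_of_no_variables (I : Ideal (MvPolynomial (Fin 0) K))
    (ℓ : quotientGrading I 1) (i : ℕ) : FullRank (mulMap (quotientGrading I) ℓ i) := by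
  refine Or.inr ?_
  rintro ⟨_, u, hu, rfl⟩
  have hu0 : u = 0 := by
    by_contra h
    have := IsHomogeneous.inj_right hu (isHomogeneous_of_isEmpty _ _ u) h
    omega
  subst hu0
  exact ⟨0, Subtype.ext (by simp)⟩

theorem hasWLP_of_fullRank_lt_regularity [Infinite K]
    (hI : I.IsHomogeneous (homogeneousSubmodule (Fin l) K)) (ℓ₀ : quotientGrading I 1)
    (h₀ : ∀ i : ℕ, (i : ℤ) < regularity I → FullRank (mulMap (quotientGrading I) ℓ₀ i)) :
    HasWLP (quotientGrading I) := by
  rcases Nat.eq_zero_or_pos l with rfl | hl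
  · exact ⟨ℓ₀, fun i => fullRank_mulMap_of_no_variables I ℓ₀ i⟩
  obtain ⟨f₀, -, hf₀⟩ := ℓ₀.2
  obtain ⟨f₁, hf₁, hrel⟩ := exists_linearForm_notMem_relevantPrimes I
  let ℓ₁ : quotientGrading I 1 := ⟨Ideal.Quotient.mk I f₁, f₁, hf₁, rfl⟩
  have hfin : (⋃ i ∈ {i : ℕ | (i : ℤ) < regularity I}, {s : K | ¬ FullRank
      (mulMap (quotientGrading I) ℓ₀ i + s • mulMap (quotientGrading I) ℓ₁ i)}).Finite := by
    refine Set.Finite.biUnion ?_ fun i hi => (h₀ i hi).finite_not_fullRank_add_smul _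
    exact (Set.finite_Iio (regularity I).toNat).subset fun i (hi : (i : ℤ) < _) => by
      rw [Set.mem_Iio]
      omega
  obtain ⟨s, hs⟩ := (hfin.union (finite_add_smul_mem_relevantPrimes f₀ hrel)).exists_notMem
  simp only [Set.mem_union, Set.mem_iUnion, Set.mem_ofPred_eq, not_or, not_exists, not_not,
    not_and] at hs
  refine ⟨ℓ₀ + s • ℓ₁, fun i => ?_⟩
  rcases lt_or_ge (i : ℤ) (regularity I) with hi | hi
  · rw [mulMap_add_smul]
    exact hs.1 i hi
  · refine Or.inl (injective_mulMap_of_regularity_le hI hl.ne' hs.2 _ ?_ hi)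
    rw [map_add]
    change (ℓ₀ : MvPolynomial (Fin l) K ⧸ I) + s • Ideal.Quotient.mk I f₁ = _
    rw [← hf₀]
    rfl

end LinearForms

end Lefschetz

theorem mainTheorem2 {K : Type*} [Field K] [CharZero K] {l : ℕ}
    (I : Ideal (MvPolynomial (Fin l) K))
    (hI : I.IsHomogeneous (MvPolynomial.homogeneousSubmodule (Fin l) K)) :
    (I ≠ ⊥ → IsGreatest (Lefschetz.regularitySet I) (Lefschetz.regularity I)) ∧
    (Lefschetz.HasWLP (Lefschetz.quotientGrading I) ↔
      ∃ ℓ : Lefschetz.quotientGrading I 1, ∀ i : ℕ,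
        (i : ℤ) ≤ Lefschetz.regularity I - 1 →
          Lefschetz.FullRank (Lefschetz.mulMap (Lefschetz.quotientGrading I) ℓ i)) := by
  refine ⟨Lefschetz.isGreatest_regularity hI, ?_, ?_⟩
  · rintro ⟨ℓ, hℓ⟩
    exact ⟨ℓ, fun i _ => hℓ i⟩
  · rintro ⟨ℓ, hℓ⟩
    have : Infinite K := CharZero.infinite K
    exact Lefschetz.hasWLP_of_fullRank_lt_regularity hI ℓ fun i hi => hℓ i (by omega)
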